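/- Let $n\ge 0$ and $d\ge 1$ be integers, let $\mathbf A\in\mathbb R^{n\times d}$ be any fixed matrix, and let $\mathbf E\in\mathbb R^{n\times d}$ be a random matrix whose entries $\mathbf E_{ij}$ are independent standard normal $\mathcal N(0,1)$ random variables. For $\mathbf M\in\mathbb R^{n\times d}$ let $\sigma_d(\mathbf M)\ge 0$ denote the square root of the smallest eigenvalue of $\mathbf M^T\mathbf M$ (for $n\ge d$ this is the smallest singular value of $\mathbf M$; for $n<d$ it is $0$). Then, for every real $t>0$, $$\mathbb P\left(\sigma_d(\mathbf A+\mathbf E)\ \ge\ \sqrt n-(1+t)\sqrt d-t\right)\ \ge\ 1-(2d+1)\,e^{-t^2/2}.$$ -/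

import Mathlib

open MeasureTheory ProbabilityTheory

/-! ### Rotation invariance of the standard Gaussian measure, via characteristic functions. -/

section GaussianMaps

open scoped RealInnerProductSpace

variable {E F F' : Type*}
  [NormedAddCommGroup E] [InnerProductSpace ℝ E] [FiniteDimensional ℝ E]
  [MeasurableSpace E] [BorelSpace E]
  [NormedAddCommGroup F] [InnerProductSpace ℝ F] [FiniteDimensional ℝ F]
  [MeasurableSpace F] [BorelSpace F]
  [NormedAddCommGroup F'] [InnerProductSpace ℝ F'] [FiniteDimensional ℝ F']
  [MeasurableSpace F'] [BorelSpace F']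

/-! If the columns of `U` are `n - d` orthonormal vectors orthogonal to the columns of `A`, then
`‖(A + E)x‖ ≥ ‖Uᵀ(A + E)x‖ = ‖UᵀEx‖`, and `Uᵀ * E` is again a Gaussian matrix. The shift thus costs
only `d` rows.

The smaller Gaussian matrix is bidiagonalized one column and one row at a time
(`measureReal_not_hasQuadLowerBound_le`). It sends a unit vector to a Gaussian vector `a`; the row
of the remaining columns in the direction of `a` is a Gaussian vector `b`, whose direction is the
next unit vector; by rotation invariance the rest is Gaussian and independent of both. The diagonal
entries `‖a‖` live in dimension at least `n - 2d + 1` and are at least `α`, the off-diagonal entries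
`‖b‖` live in dimension less than `d` and are at most `β`, up to `2d` exceptional events controlled
by chi-square Chernoff bounds.

For such a bidiagonal matrix, `HasQuadLowerBound.of_frames` gives smallest singular value at least
`α - β`. With `α = √(n - 2d + 1) - t / √2` and `β = √d + t`, `threshold_comparison` shows that this
exceeds the required threshold whenever the claim is not trivial. -/

/-- A map whose adjoint is an isometry pushes the standard Gaussian measure to the standard
Gaussian measure. -/
theorem stdGaussian_map_of_adjoint {L : E → F} (hL : Measurable L) (L' : F → E)
    (hadj : ∀ x y, ⟪L x, y⟫ = ⟪x, L' y⟫) (hnorm : ∀ y, ‖L' y‖ ^ 2 = ‖y‖ ^ 2) :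
    (stdGaussian E).map L = stdGaussian F := by
  have := Measure.isProbabilityMeasure_map (μ := stdGaussian E) hL.aemeasurable
  apply Measure.ext_of_charFun
  ext y
  have h := charFun_stdGaussian (L' y)
  rw [charFun_apply] at h ⊢
  rw [integral_map hL.aemeasurable (Measurable.aestronglyMeasurable (by fun_prop))]
  simp_rw [hadj, h, charFun_stdGaussian, ← Complex.ofReal_pow, hnorm]

/-- Two maps with jointly isometric adjoint push the standard Gaussian measure to a product of
standard Gaussian measures. -/
theorem stdGaussian_map_prodMk_of_adjoint {L₁ : E → F} {L₂ : E → F'} (hL₁ : Measurable L₁)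
    (hL₂ : Measurable L₂) (L' : F → F' → E)
    (hadj : ∀ x y z, ⟪L₁ x, y⟫ + ⟪L₂ x, z⟫ = ⟪x, L' y z⟫)
    (hnorm : ∀ y z, ‖L' y z‖ ^ 2 = ‖y‖ ^ 2 + ‖z‖ ^ 2) :
    (stdGaussian E).map (fun x => (L₁ x, L₂ x)) = (stdGaussian F).prod (stdGaussian F') := by
  have hL : Measurable fun x => (L₁ x, L₂ x) := hL₁.prodMk hL₂
  have := Measure.isProbabilityMeasure_map (μ := stdGaussian E) hL.aemeasurable
  rw [← charFun_eq_prod_iff]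
  intro p
  rw [Measure.map_map (by fun_prop) hL]
  have h := charFun_stdGaussian (L' (WithLp.ofLp p).1 (WithLp.ofLp p).2)
  rw [charFun_apply] at h ⊢
  rw [integral_map (by fun_prop) (Measurable.aestronglyMeasurable (by fun_prop))]
  simp only [Function.comp_apply, WithLp.prod_inner_apply, hadj, h, charFun_stdGaussian,
    ← Complex.ofReal_pow, hnorm]
  rw [← Complex.exp_add]
  push_cast
  ring_nf

end GaussianMaps

/-! ### Orthonormal frames and the deterministic bidiagonalization step. -/

section Frames

open Matrix

/-- A unit vector `v` together with a matrix `V` whose columns complete it to an orthonormal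
basis. -/
structure IsOrthFrame {d : ℕ} (v : Fin (d + 1) → ℝ) (V : Matrix (Fin (d + 1)) (Fin d) ℝ) :
    Prop where
  dot_self : v ⬝ᵥ v = 1
  transpose_mulVec : Vᵀ *ᵥ v = 0
  transpose_mul : Vᵀ * V = 1
  decomp : ∀ x, (v ⬝ᵥ x) • v + V *ᵥ (Vᵀ *ᵥ x) = x

theorem exists_isOrthFrame {d : ℕ} (v : Fin (d + 1) → ℝ) (hv : v ⬝ᵥ v = 1) :
    ∃ V, IsOrthFrame v V := by
  have hnorm : ‖WithLp.toLp 2 v‖ = 1 := by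
    rw [← sq_eq_sq₀ (norm_nonneg _) zero_le_one, EuclideanSpace.real_norm_sq_eq, one_pow, ← hv]
    simp [dotProduct, sq]
  have ho : Orthonormal ℝ (({0} : Set (Fin (d + 1))).domRestrict
      fun _ => (WithLp.toLp 2 v : EuclideanSpace ℝ (Fin (d + 1)))) := by
    refine ⟨fun i => hnorm, fun i j hij => absurd (Subsingleton.elim i j) hij⟩
  obtain ⟨b, hb⟩ := ho.exists_orthonormalBasis_extension_of_card_eq (by simp)
  have hb0 : ∀ i, b 0 i = v i := fun i => by rw [hb 0 rfl]
  have hbb : ∀ i j, ∑ k, b i k * b j k = if i = j then 1 else 0 := fun i j => by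
    have := orthonormal_iff_ite.1 b.orthonormal i j
    rw [← this, PiLp.inner_apply]
    exact Finset.sum_congr rfl fun k _ => by simp [mul_comm]
  have hsum : ∀ x : Fin (d + 1) → ℝ, ∀ i, ∑ k, (∑ l, b k l * x l) * b k i = x i := fun x i => by
    have := congrArg (fun y : EuclideanSpace ℝ (Fin (d + 1)) => y i)
      (b.sum_repr' (WithLp.toLp 2 x))
    simp only [WithLp.ofLp_sum, Finset.sum_apply, PiLp.smul_apply, smul_eq_mul] at this
    rw [← this]
    refine Finset.sum_congr rfl fun k _ => ?_
    congr 1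
    rw [PiLp.inner_apply]
    exact Finset.sum_congr rfl fun k _ => by simp [mul_comm]
  refine ⟨Matrix.of fun i j => b j.succ i, hv, ?_, ?_, ?_⟩
  · ext j
    simpa [mulVec, dotProduct, hb0] using hbb j.succ 0
  · ext i j
    simpa [mul_apply, one_apply] using hbb i.succ j.succ
  · intro x
    ext i
    have := hsum x i
    rw [Fin.sum_univ_succ] at this
    simp only [hb0] at this
    rw [← this]
    change (∑ l, v l * x l) * v i + ∑ k : Fin d, b k.succ i * ∑ l, b k.succ l * x l = _
    exact congrArg _ (Finset.sum_congr rfl fun k _ => mul_comm _ _)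

/-- For every `n × d` matrix there are `n - d` orthonormal vectors orthogonal to its columns. -/
theorem exists_orthonormal_columns_orthogonal {m d : ℕ} (A : Matrix (Fin (m + d)) (Fin d) ℝ) :
    ∃ U : Matrix (Fin (m + d)) (Fin m) ℝ, Uᵀ * U = 1 ∧ Uᵀ * A = 0 := by
  let S : Submodule ℝ (EuclideanSpace ℝ (Fin (m + d))) :=
    Submodule.span ℝ (Set.range fun j => WithLp.toLp 2 fun i => A i j)
  have hS : Module.finrank ℝ S ≤ d :=
    (finrank_range_le_card (R := ℝ) (fun j : Fin d =>
      (WithLp.toLp 2 fun i => A i j : EuclideanSpace ℝ (Fin (m + d))))).trans_eq (Fintype.card_fin d)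
  have hST := S.finrank_add_finrank_orthogonal
  rw [finrank_euclideanSpace, Fintype.card_fin] at hST
  have hm : m ≤ Module.finrank ℝ Sᗮ := by omega
  let b := stdOrthonormalBasis ℝ Sᗮ
  let c : Fin m → EuclideanSpace ℝ (Fin (m + d)) := fun i => (b (Fin.castLE hm i) : _)
  have hc : Orthonormal ℝ c := by
    have := (b.orthonormal.comp (Fin.castLE hm) (Fin.castLE_injective hm))
    exact this.comp_linearIsometry Sᗮ.subtypeₗᵢ
  refine ⟨Matrix.of fun i j => c j i, ?_, ?_⟩
  · ext i j
    have := orthonormal_iff_ite.1 hc i j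
    rw [← one_apply, PiLp.inner_apply] at this
    rw [← this, mul_apply]
    exact Finset.sum_congr rfl fun k _ => mul_comm (c i k) (c j k)
  · ext i j
    have h1 : (WithLp.toLp 2 fun i => A i j : EuclideanSpace ℝ (Fin (m + d))) ∈ S :=
      Submodule.subset_span ⟨j, rfl⟩
    have := Submodule.inner_right_of_mem_orthogonal h1 (b (Fin.castLE hm i)).2
    rw [PiLp.inner_apply] at this
    exact this

namespace IsOrthFrame

variable {d : ℕ} {v : Fin (d + 1) → ℝ} {V : Matrix (Fin (d + 1)) (Fin d) ℝ}

theorem dot_combination (h : IsOrthFrame v V) (c : ℝ) (z : Fin d → ℝ) :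
    (c • v + V *ᵥ z) ⬝ᵥ (c • v + V *ᵥ z) = c ^ 2 + z ⬝ᵥ z := by
  have h1 : v ⬝ᵥ (V *ᵥ z) = 0 := by
    rw [dotProduct_mulVec, ← mulVec_transpose, h.transpose_mulVec, zero_dotProduct]
  have h2 : (V *ᵥ z) ⬝ᵥ (V *ᵥ z) = z ⬝ᵥ z := by
    rw [dotProduct_mulVec, ← mulVec_transpose, mulVec_mulVec, h.transpose_mul, one_mulVec]
  simp only [add_dotProduct, dotProduct_add, smul_dotProduct, dotProduct_smul, smul_eq_mul,
    h.dot_self, dotProduct_comm _ v, h1, h2]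
  ring

theorem vecMulVec_add_mul_transpose (h : IsOrthFrame v V) : vecMulVec v v + V * Vᵀ = 1 := by
  refine ext_of_mulVec_single fun j => ?_
  rw [add_mulVec, ← mulVec_mulVec, vecMulVec_mulVec, one_mulVec]
  simpa using h.decomp (Pi.single j 1)

theorem dot_eq (h : IsOrthFrame v V) (x : Fin (d + 1) → ℝ) :
    x ⬝ᵥ x = (v ⬝ᵥ x) ^ 2 + (Vᵀ *ᵥ x) ⬝ᵥ (Vᵀ *ᵥ x) := by
  rw [← h.dot_combination, h.decomp]

end IsOrthFrame

theorem dot_transpose_mulVec_le {m k : ℕ} {U : Matrix (Fin m) (Fin k) ℝ} (hU : Uᵀ * U = 1)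
    (x : Fin m → ℝ) : (Uᵀ *ᵥ x) ⬝ᵥ (Uᵀ *ᵥ x) ≤ x ⬝ᵥ x := by
  have h1 : (U *ᵥ (Uᵀ *ᵥ x)) ⬝ᵥ (U *ᵥ (Uᵀ *ᵥ x)) = (Uᵀ *ᵥ x) ⬝ᵥ (Uᵀ *ᵥ x) := by
    rw [dotProduct_mulVec, ← mulVec_transpose, mulVec_mulVec, hU, one_mulVec]
  have h2 : x ⬝ᵥ (U *ᵥ (Uᵀ *ᵥ x)) = (Uᵀ *ᵥ x) ⬝ᵥ (Uᵀ *ᵥ x) := by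
    rw [dotProduct_mulVec, ← mulVec_transpose]
  have h3 : 0 ≤ (x - U *ᵥ (Uᵀ *ᵥ x)) ⬝ᵥ (x - U *ᵥ (Uᵀ *ᵥ x)) :=
    Finset.sum_nonneg fun i _ => mul_self_nonneg _
  simp only [sub_dotProduct, dotProduct_sub, h1, dotProduct_comm _ x, h2] at h3
  linarith

/-- The quadratic lower bound propagated by the bidiagonalization. -/
def HasQuadLowerBound {m d : ℕ} (α β : ℝ) (v : Fin d → ℝ) (M : Matrix (Fin m) (Fin d) ℝ) : Prop :=
  ∀ x, (α - β) ^ 2 * (x ⬝ᵥ x) + β * (α - β) * (v ⬝ᵥ x) ^ 2 ≤ (M *ᵥ x) ⬝ᵥ (M *ᵥ x)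

/-- The extra term `β * (α - β) * (v ⬝ᵥ x) ^ 2` makes the bound reproduce itself: the term along `w`
supplied by the smaller block absorbs the cross term between the diagonal entry `r` and the
off-diagonal row, and a term of the same shape along `v` is left over. -/
theorem HasQuadLowerBound.of_frames {m d : ℕ} {α β : ℝ} (hβ : 0 ≤ β) (hαβ : β ≤ α)
    {v : Fin (d + 1) → ℝ} {V : Matrix (Fin (d + 1)) (Fin d) ℝ} (hV : IsOrthFrame v V)
    {u : Fin (m + 1) → ℝ} {U : Matrix (Fin (m + 1)) (Fin m) ℝ} (hU : IsOrthFrame u U)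
    {M : Matrix (Fin (m + 1)) (Fin (d + 1)) ℝ} {r : ℝ} (hr : α ≤ r) (hMv : M *ᵥ v = r • u)
    {w : Fin d → ℝ} (hw : ∀ y, (((M * V)ᵀ *ᵥ u) ⬝ᵥ y) ^ 2 ≤ β ^ 2 * (w ⬝ᵥ y) ^ 2)
    (hM : HasQuadLowerBound α β w (Uᵀ * (M * V))) :
    HasQuadLowerBound α β v M := by
  intro x
  set y := Vᵀ *ᵥ x with hy
  have hx : M *ᵥ x = (r * (v ⬝ᵥ x)) • u + (M * V) *ᵥ y := by
    conv_lhs => rw [← hV.decomp x]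
    rw [mulVec_add, mulVec_smul, hMv, smul_smul, mul_comm, mulVec_mulVec]
  have h1 : u ⬝ᵥ (M *ᵥ x) = r * (v ⬝ᵥ x) + ((M * V)ᵀ *ᵥ u) ⬝ᵥ y := by
    rw [hx, dotProduct_add, dotProduct_smul, hU.dot_self, dotProduct_mulVec, ← mulVec_transpose]
    simp
  have h2 : Uᵀ *ᵥ (M *ᵥ x) = (Uᵀ * (M * V)) *ᵥ y := by
    rw [hx, mulVec_add, mulVec_smul, hU.transpose_mulVec, smul_zero, zero_add, mulVec_mulVec]
  rw [hV.dot_eq x, hU.dot_eq (M *ᵥ x), h1, h2, ← hy]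
  have h3 := hM y
  have h4 := hw y
  set p := v ⬝ᵥ x
  set q := ((M * V)ᵀ *ᵥ u) ⬝ᵥ y
  set s := w ⬝ᵥ y
  -- The `y ⬝ᵥ y` terms cancel, and `(α - β) ^ 2 + β * (α - β) = α * (α - β)`.
  suffices h : α * (α - β) * p ^ 2 ≤ (r * p + q) ^ 2 + β * (α - β) * s ^ 2 by nlinarith
  rcases hβ.eq_or_lt with rfl | hβ
  · have hq : q = 0 := by
      have : q ^ 2 ≤ 0 := by simpa using h4
      nlinarith
    rw [hq]
    have : α ^ 2 ≤ r ^ 2 := pow_le_pow_left₀ hαβ hr 2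
    nlinarith [sq_nonneg p]
  · have hα : 0 < α := hβ.trans_le hαβ
    have hr2 : α ^ 2 ≤ r ^ 2 := pow_le_pow_left₀ hα.le hr 2
    have h5 : (α - β) * q ^ 2 ≤ β * (β * (α - β) * s ^ 2) := by nlinarith
    -- Completing the square in `q`, once `s ^ 2` has been traded for `q ^ 2 / β ^ 2`.
    have h6 : α * (β * (r * p + q) ^ 2 + (α - β) * q ^ 2) =
        (α * q + β * (r * p)) ^ 2 + β * (α - β) * (r ^ 2 * p ^ 2) := by ring
    have h7 : β * (α - β) * (α ^ 2 * p ^ 2) ≤ β * (α - β) * (r ^ 2 * p ^ 2) := by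
      have := sub_nonneg.2 hαβ
      gcongr
    have h8 : α * (β * (α * (α - β) * p ^ 2)) ≤
        α * (β * (r * p + q) ^ 2 + (α - β) * q ^ 2) := by
      rw [h6]
      nlinarith [sq_nonneg (α * q + β * (r * p))]
    have h9 := le_of_mul_le_mul_left h8 hα
    refine le_of_mul_le_mul_left ?_ hβ
    linarith

end Frames

/-! ### Chernoff bounds for the norm of a standard Gaussian vector. -/

section Tails

open Real

theorem integral_exp_mul_sq_gaussianReal {l : ℝ} (hl : l < 1 / 2) :
    ∫ x, exp (l * x ^ 2) ∂gaussianReal 0 1 = (√(1 - 2 * l))⁻¹ := by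
  rw [integral_gaussianReal_eq_integral_smul one_ne_zero]
  have h : ∀ x : ℝ, gaussianPDFReal 0 1 x • exp (l * x ^ 2) =
      (√(2 * π))⁻¹ * exp (-(1 / 2 - l) * x ^ 2) := fun x => by
    simp only [gaussianPDFReal, smul_eq_mul, NNReal.coe_one, mul_one, sub_zero]
    rw [mul_assoc, ← exp_add]
    ring_nf
  simp_rw [h]
  rw [integral_const_mul, integral_gaussian, ← sqrt_inv, ← sqrt_inv,
    ← sqrt_mul (by positivity)]
  congr 1
  have : 1 - 2 * l ≠ 0 := by linarith
  have : 1 / 2 - l ≠ 0 := by linarith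
  field_simp

variable {k : ℕ}

theorem integral_exp_mul_norm_sq_stdGaussian {l : ℝ} (hl : l < 1 / 2) :
    ∫ x, exp (l * ‖x‖ ^ 2) ∂stdGaussian (EuclideanSpace ℝ (Fin k)) = (√(1 - 2 * l))⁻¹ ^ k := by
  rw [← map_pi_eq_stdGaussian, integral_map (by fun_prop) (by fun_prop)]
  simp_rw [EuclideanSpace.real_norm_sq_eq, Finset.mul_sum, exp_sum]
  rw [integral_fintype_prod_eq_prod (f := fun _ x => exp (l * x ^ 2))]
  simp [integral_exp_mul_sq_gaussianReal hl]

theorem integrable_exp_mul_norm_sq_stdGaussian {l : ℝ} (hl : l < 1 / 2) :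
    Integrable (fun x => exp (l * ‖x‖ ^ 2)) (stdGaussian (EuclideanSpace ℝ (Fin k))) := by
  refine Integrable.of_integral_ne_zero ?_
  rw [integral_exp_mul_norm_sq_stdGaussian hl]
  have : 0 < 1 - 2 * l := by linarith
  positivity

/-- The parameter `(1 - k / r ^ 2) / 2` is the minimizer of the Chernoff bound at `r ^ 2`. It is
nonnegative for `r ≥ √k` and nonpositive for `r ≤ √k`, so both tails use it. -/
theorem chernoff_factor_eq (hk : 0 < k) {r : ℝ} (hr : 0 < r) :
    exp (-((1 - k / r ^ 2) / 2) * r ^ 2) * (√(1 - 2 * ((1 - k / r ^ 2) / 2)))⁻¹ ^ k =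
      exp (-(r ^ 2 - k) / 2 + k * log (r / √k)) := by
  have hk' : (0 : ℝ) < k := by exact_mod_cast hk
  have h1 : (√(1 - 2 * ((1 - k / r ^ 2) / 2)))⁻¹ = r / √k := by
    rw [show 1 - 2 * ((1 - k / r ^ 2) / 2) = k / r ^ 2 by ring, sqrt_div' _ (by positivity),
      sqrt_sq hr.le, inv_div]
  rw [h1, exp_add, mul_comm (k : ℝ), ← rpow_def_of_pos (by positivity), rpow_natCast]
  congr 2
  field_simp

theorem stdGaussian_norm_ge_le (k : ℕ) {t : ℝ} (ht : 0 < t) :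
    (stdGaussian (EuclideanSpace ℝ (Fin k))).real {x | √k + t ≤ ‖x‖} ≤ exp (-t ^ 2 / 2) := by
  rcases Nat.eq_zero_or_pos k with rfl | hk
  · have : {x : EuclideanSpace ℝ (Fin 0) | √((0 : ℕ) : ℝ) + t ≤ ‖x‖} = ∅ := by
      ext x
      simp [Subsingleton.elim x 0, ht]
    rw [this]
    simp [exp_nonneg]
  have hk' : (0 : ℝ) < k := by exact_mod_cast hk
  set c := √(k : ℝ) with hc
  have hc0 : 0 < c := sqrt_pos.2 hk'
  have hcc : c ^ 2 = k := sq_sqrt hk'.le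
  have hr : 0 < c + t := by positivity
  set l := (1 - k / (c + t) ^ 2) / 2 with hl
  have hkr : (k : ℝ) ≤ (c + t) ^ 2 := by nlinarith
  have hl0 : 0 ≤ l := by
    have : k / (c + t) ^ 2 ≤ 1 := (div_le_one (by positivity)).2 hkr
    rw [hl]; linarith
  have hl1 : l < 1 / 2 := by
    have : 0 < k / (c + t) ^ 2 := by positivity
    rw [hl]; linarith
  have hset : {x : EuclideanSpace ℝ (Fin k) | c + t ≤ ‖x‖} = {x | (c + t) ^ 2 ≤ ‖x‖ ^ 2} := by
    ext x
    exact (pow_le_pow_iff_left₀ hr.le (norm_nonneg x) two_ne_zero).symm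
  have h := measure_ge_le_exp_mul_mgf ((c + t) ^ 2) hl0
    (integrable_exp_mul_norm_sq_stdGaussian (k := k) hl1)
  rw [mgf, integral_exp_mul_norm_sq_stdGaussian hl1, hl, chernoff_factor_eq hk hr] at h
  rw [hset]
  refine h.trans (exp_le_exp.2 ?_)
  have hlog : log ((c + t) / c) ≤ t / c := by
    have := log_le_sub_one_of_pos (x := (c + t) / c) (by positivity)
    rwa [add_div, div_self hc0.ne', add_sub_cancel_left, ← div_self hc0.ne', ← add_div] at this
  have : k * log ((c + t) / c) ≤ c * t := by
    calc k * log ((c + t) / c) ≤ k * (t / c) := by gcongr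
      _ = c * t := by rw [← hcc]; field_simp
  rw [← hc]
  nlinarith

theorem log_one_sub_le {u : ℝ} (h0 : 0 ≤ u) (h1 : u < 1) : log (1 - u) ≤ -u - u ^ 2 / 2 := by
  have h := hasSum_pow_div_log_of_abs_lt_one (x := u) (by rwa [abs_of_nonneg h0])
  have := h.summable.sum_le_tsum (Finset.range 2) fun i _ => by positivity
  rw [h.tsum_eq] at this
  norm_num [Finset.sum_range_succ] at this
  linarith

/-- The second-order bound on `log (1 - u)` gains another `s ^ 2 / 2` over the upper tail. Hence a
deviation of only `t / √2` suffices for probability `exp (-t ^ 2 / 2)`. -/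
theorem stdGaussian_norm_lt_le (k : ℕ) {s : ℝ} (hs : 0 ≤ s) :
    (stdGaussian (EuclideanSpace ℝ (Fin k))).real {x | ‖x‖ < √k - s} ≤ exp (-s ^ 2) := by
  rcases le_or_gt (√k - s) 0 with hr | hr
  · have : {x : EuclideanSpace ℝ (Fin k) | ‖x‖ < √k - s} = ∅ := by
      ext x
      simpa using hr.trans (norm_nonneg x)
    rw [this]
    simp [exp_nonneg]
  set c := √(k : ℝ) with hc
  have hc0 : 0 < c := by linarith
  have hk' : (0 : ℝ) < k := sqrt_pos.1 hc0
  have hk : 0 < k := by exact_mod_cast hk'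
  have hcc : c ^ 2 = k := sq_sqrt hk'.le
  set l := (1 - k / (c - s) ^ 2) / 2 with hl
  have hkr : (c - s) ^ 2 ≤ k := by nlinarith
  have hl0 : l ≤ 0 := by
    have : 1 ≤ k / (c - s) ^ 2 := (one_le_div (by positivity)).2 hkr
    rw [hl]; linarith
  have h := measure_le_le_exp_mul_mgf ((c - s) ^ 2) hl0
    (integrable_exp_mul_norm_sq_stdGaussian (k := k) (by linarith))
  rw [mgf, integral_exp_mul_norm_sq_stdGaussian (by linarith), hl, chernoff_factor_eq hk hr] at h
  refine (measureReal_mono fun x hx => ?_).trans (h.trans (exp_le_exp.2 ?_))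
  · exact pow_le_pow_left₀ (norm_nonneg x) (le_of_lt hx) 2
  have hlog : log ((c - s) / c) ≤ -(s / c) - (s / c) ^ 2 / 2 := by
    rw [sub_div, div_self hc0.ne']
    exact log_one_sub_le (by positivity) ((div_lt_one hc0).2 (by linarith))
  have : k * log ((c - s) / c) ≤ -(c * s) - s ^ 2 / 2 := by
    calc k * log ((c - s) / c) ≤ k * (-(s / c) - (s / c) ^ 2 / 2) := by gcongr
      _ = -(c * s) - s ^ 2 / 2 := by rw [← hcc]; field_simp
  rw [← hc]
  nlinarith

end Tails

/-! ### Gaussian matrices in adapted frames and the probabilistic induction. -/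

section GaussianMatrices

open Matrix
open scoped RealInnerProductSpace

variable {m d k : ℕ}

/-- The matrix whose entries are the coordinates of a vector. -/
def matrixOfVec (G : EuclideanSpace ℝ (Fin m × Fin d)) : Matrix (Fin m) (Fin d) ℝ :=
  Matrix.of fun i j => G (i, j)

/-- The vector of the entries of a matrix. -/
def vecOfMatrix (M : Matrix (Fin m) (Fin d) ℝ) : EuclideanSpace ℝ (Fin m × Fin d) :=
  WithLp.toLp 2 fun p => M p.1 p.2

@[simp] theorem matrixOfVec_apply (G : EuclideanSpace ℝ (Fin m × Fin d)) (i : Fin m) (j : Fin d) :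
    matrixOfVec G i j = G (i, j) := rfl

@[simp] theorem matrixOfVec_vecOfMatrix (M : Matrix (Fin m) (Fin d) ℝ) :
    matrixOfVec (vecOfMatrix M) = M := rfl

@[fun_prop] theorem continuous_matrixOfVec :
    Continuous (matrixOfVec : EuclideanSpace ℝ (Fin m × Fin d) → _) :=
  continuous_matrix fun i j => by simp only [matrixOfVec_apply]; fun_prop

@[fun_prop] theorem continuous_vecOfMatrix :
    Continuous (vecOfMatrix : Matrix (Fin m) (Fin d) ℝ → _) :=
  (PiLp.continuous_toLp 2 _).comp
    (continuous_pi fun p => (continuous_apply p.2).comp (continuous_apply p.1))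

theorem inner_eq_sum_entries (G H : EuclideanSpace ℝ (Fin m × Fin d)) :
    ⟪G, H⟫ = ∑ i, ∑ j, G (i, j) * H (i, j) := by
  rw [PiLp.inner_apply, Fintype.sum_prod_type]
  exact Finset.sum_congr rfl fun i _ => Finset.sum_congr rfl fun j _ => mul_comm _ _

theorem norm_sq_eq_sum_rows (G : EuclideanSpace ℝ (Fin m × Fin d)) :
    ‖G‖ ^ 2 = ∑ i, matrixOfVec G i ⬝ᵥ matrixOfVec G i := by
  rw [← real_inner_self_eq_norm_sq, inner_eq_sum_entries]
  rfl

theorem norm_sq_eq_sum_cols (G : EuclideanSpace ℝ (Fin m × Fin d)) :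
    ‖G‖ ^ 2 = ∑ j, (matrixOfVec G)ᵀ j ⬝ᵥ (matrixOfVec G)ᵀ j := by
  rw [← real_inner_self_eq_norm_sq, inner_eq_sum_entries, Finset.sum_comm]
  rfl

theorem norm_sq_eq_dotProduct (x : EuclideanSpace ℝ (Fin d)) :
    ‖x‖ ^ 2 = WithLp.ofLp x ⬝ᵥ WithLp.ofLp x := by
  rw [EuclideanSpace.real_norm_sq_eq]
  simp [dotProduct, sq]

theorem inner_eq_dotProduct (x y : EuclideanSpace ℝ (Fin d)) :
    ⟪x, y⟫ = WithLp.ofLp x ⬝ᵥ WithLp.ofLp y := by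
  rw [PiLp.inner_apply]
  exact Finset.sum_congr rfl fun j _ => mul_comm _ _

/-- In an orthonormal frame of the domain, the first column of a Gaussian matrix is independent of
the other ones. -/
theorem map_columns_stdGaussian {v : Fin (d + 1) → ℝ} {V : Matrix (Fin (d + 1)) (Fin d) ℝ}
    (h : IsOrthFrame v V) :
    (stdGaussian (EuclideanSpace ℝ (Fin m × Fin (d + 1)))).map
      (fun G => (WithLp.toLp 2 (matrixOfVec G *ᵥ v), vecOfMatrix (matrixOfVec G * V))) =
    (stdGaussian (EuclideanSpace ℝ (Fin m))).prod
      (stdGaussian (EuclideanSpace ℝ (Fin m × Fin d))) := by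
  refine stdGaussian_map_prodMk_of_adjoint (Continuous.measurable (by fun_prop))
    (Continuous.measurable (by fun_prop))
    (fun y Z => vecOfMatrix (Matrix.of fun i => y i • v + V *ᵥ matrixOfVec Z i))
    (fun G y Z => ?_) (fun y Z => ?_)
  · rw [inner_eq_dotProduct, inner_eq_sum_entries, inner_eq_sum_entries, dotProduct,
      ← Finset.sum_add_distrib]
    refine Finset.sum_congr rfl fun i _ => ?_
    change (matrixOfVec G i ⬝ᵥ v) * y i + (matrixOfVec G i ᵥ* V) ⬝ᵥ matrixOfVec Z i =
      matrixOfVec G i ⬝ᵥ (y i • v + V *ᵥ matrixOfVec Z i)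
    rw [dotProduct_add, dotProduct_smul, dotProduct_mulVec, smul_eq_mul, mul_comm]
  · rw [norm_sq_eq_sum_rows, norm_sq_eq_sum_rows, norm_sq_eq_dotProduct, dotProduct,
      ← Finset.sum_add_distrib]
    refine Finset.sum_congr rfl fun i _ => ?_
    rw [← sq]
    exact h.dot_combination (y i) (matrixOfVec Z i)

/-- In an orthonormal frame of the codomain, the first row of a Gaussian matrix is independent of
the other ones. -/
theorem map_rows_stdGaussian {u : Fin (m + 1) → ℝ} {U : Matrix (Fin (m + 1)) (Fin m) ℝ}
    (h : IsOrthFrame u U) :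
    (stdGaussian (EuclideanSpace ℝ (Fin (m + 1) × Fin d))).map
      (fun G => (WithLp.toLp 2 ((matrixOfVec G)ᵀ *ᵥ u), vecOfMatrix (Uᵀ * matrixOfVec G))) =
    (stdGaussian (EuclideanSpace ℝ (Fin d))).prod
      (stdGaussian (EuclideanSpace ℝ (Fin m × Fin d))) := by
  refine stdGaussian_map_prodMk_of_adjoint (Continuous.measurable (by fun_prop))
    (Continuous.measurable (by fun_prop))
    (fun y Z => vecOfMatrix (Matrix.of fun j => y j • u + U *ᵥ (matrixOfVec Z)ᵀ j)ᵀ)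
    (fun G y Z => ?_) (fun y Z => ?_)
  · rw [inner_eq_dotProduct, inner_eq_sum_entries, inner_eq_sum_entries, dotProduct,
      Finset.sum_comm, ← Finset.sum_add_distrib, Finset.sum_comm (s := Finset.univ (α := Fin (m + 1)))]
    refine Finset.sum_congr rfl fun j _ => ?_
    change ((matrixOfVec G)ᵀ j ⬝ᵥ u) * y j + (Uᵀ *ᵥ (matrixOfVec G)ᵀ j) ⬝ᵥ (matrixOfVec Z)ᵀ j =
      (matrixOfVec G)ᵀ j ⬝ᵥ (y j • u + U *ᵥ (matrixOfVec Z)ᵀ j)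
    rw [dotProduct_add, dotProduct_smul, dotProduct_mulVec, smul_eq_mul, mul_comm,
      mulVec_transpose]
  · rw [norm_sq_eq_sum_cols, norm_sq_eq_sum_cols, norm_sq_eq_dotProduct, dotProduct,
      ← Finset.sum_add_distrib]
    refine Finset.sum_congr rfl fun j _ => ?_
    rw [← sq]
    exact h.dot_combination (y j) ((matrixOfVec Z)ᵀ j)

/-- Compressing a Gaussian matrix by orthonormal columns gives a Gaussian matrix. -/
theorem map_compression_stdGaussian {U : Matrix (Fin k) (Fin m) ℝ} (hU : Uᵀ * U = 1) :
    (stdGaussian (EuclideanSpace ℝ (Fin k × Fin d))).map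
      (fun G => vecOfMatrix (Uᵀ * matrixOfVec G)) =
    stdGaussian (EuclideanSpace ℝ (Fin m × Fin d)) := by
  refine stdGaussian_map_of_adjoint (Continuous.measurable (by fun_prop))
    (fun Z => vecOfMatrix (Matrix.of fun j => U *ᵥ (matrixOfVec Z)ᵀ j)ᵀ)
    (fun G Z => ?_) (fun Z => ?_)
  · rw [inner_eq_sum_entries, inner_eq_sum_entries, Finset.sum_comm,
      Finset.sum_comm (s := Finset.univ (α := Fin k))]
    refine Finset.sum_congr rfl fun j _ => ?_
    change (Uᵀ *ᵥ (matrixOfVec G)ᵀ j) ⬝ᵥ (matrixOfVec Z)ᵀ j =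
      (matrixOfVec G)ᵀ j ⬝ᵥ (U *ᵥ (matrixOfVec Z)ᵀ j)
    rw [dotProduct_mulVec, mulVec_transpose]
  · rw [norm_sq_eq_sum_cols, norm_sq_eq_sum_cols]
    refine Finset.sum_congr rfl fun j _ => ?_
    change (U *ᵥ (matrixOfVec Z)ᵀ j) ⬝ᵥ (U *ᵥ (matrixOfVec Z)ᵀ j) = _
    rw [dotProduct_mulVec, ← mulVec_transpose, mulVec_mulVec, hU, one_mulVec]

theorem isClosed_hasQuadLowerBound {X : Type*} [TopologicalSpace X]
    {F : X → Matrix (Fin m) (Fin d) ℝ} (hF : Continuous F) (α β : ℝ) (v : Fin d → ℝ) :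
    IsClosed {x | HasQuadLowerBound α β v (F x)} := by
  simp only [HasQuadLowerBound, Set.ofPred_forall]
  exact isClosed_iInter fun x => isClosed_le continuous_const (by fun_prop)

/-- A union bound along the first factor of a product measure. -/
theorem measureReal_le_of_map_eq_prod {X Y Z : Type*} [MeasurableSpace X] [MeasurableSpace Y]
    [MeasurableSpace Z] {ρ : Measure Z} {μ : Measure X} {ν : Measure Y} [IsProbabilityMeasure ρ]
    [IsProbabilityMeasure μ] [IsProbabilityMeasure ν] {f : Z → X} {g : Z → Y}
    (hfg : Measurable fun z => (f z, g z)) (h : ρ.map (fun z => (f z, g z)) = μ.prod ν)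
    {S : Set (X × Y)} (hS : MeasurableSet S) {N : Set X} (hN : MeasurableSet N) {ε δ : ℝ}
    (hδ : 0 ≤ δ) (hμ : μ.real N ≤ ε) (hν : ∀ x ∉ N, ν.real (Prod.mk x ⁻¹' S) ≤ δ) :
    ρ.real {z | (f z, g z) ∈ S} ≤ ε + δ := by
  have h1 : ρ.real {z | (f z, g z) ∈ S} = (μ.prod ν).real S := by
    rw [← h, map_measureReal_apply hfg hS]
    rfl
  have hint : Integrable (fun x => ν.real (Prod.mk x ⁻¹' S)) μ := by
    refine Integrable.of_bound (C := 1)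
      (measurable_measure_prodMk_left hS).ennreal_toReal.aestronglyMeasurable
      (Filter.Eventually.of_forall fun x => ?_)
    rw [Real.norm_of_nonneg measureReal_nonneg]
    exact measureReal_le_one
  have h2 : (μ.prod ν).real S = ∫ x, ν.real (Prod.mk x ⁻¹' S) ∂μ := by
    rw [measureReal_def, Measure.prod_apply hS, integral_eq_lintegral_of_nonneg_ae
      (Filter.Eventually.of_forall fun x => measureReal_nonneg) hint.1]
    simp [ofReal_measureReal]
  rw [h1, h2]
  -- After Fubini, a fibre has measure at most `1` over `N` and at most `δ` elsewhere.
  calc ∫ x, ν.real (Prod.mk x ⁻¹' S) ∂μ ≤ ∫ x, (N.indicator (fun _ => (1 : ℝ)) x + δ) ∂μ := by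
        refine integral_mono hint
          (((integrable_const (1 : ℝ)).indicator hN).add (integrable_const δ)) fun x => ?_
        by_cases hx : x ∈ N
        · simpa [hx] using (measureReal_le_one).trans (le_add_of_nonneg_right hδ)
        · simpa [hx] using hν x hx
    _ = μ.real N + δ := by
        rw [integral_add ((integrable_const (1 : ℝ)).indicator hN) (integrable_const δ),
          integral_indicator hN]
        simp
    _ ≤ ε + δ := by gcongr

/-- Only `w ⬝ᵥ w ≤ 1` is asked in general, since for `d = 0` there is no unit vector. -/
theorem exists_normalization (v : Fin d → ℝ) :
    ∃ w, w ⬝ᵥ w ≤ 1 ∧ (v ≠ 0 → w ⬝ᵥ w = 1) ∧ ∀ x, (v ⬝ᵥ x) ^ 2 = (v ⬝ᵥ v) * (w ⬝ᵥ x) ^ 2 := by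
  rcases eq_or_ne v 0 with rfl | hv
  · exact ⟨0, by simp, fun h => absurd rfl h, by simp⟩
  have hpos : 0 < v ⬝ᵥ v :=
    (Finset.sum_nonneg fun i _ => mul_self_nonneg _).lt_of_ne' (dotProduct_self_eq_zero.not.2 hv)
  have hs : √(v ⬝ᵥ v) ^ 2 = v ⬝ᵥ v := Real.sq_sqrt hpos.le
  have hs0 : 0 < √(v ⬝ᵥ v) := Real.sqrt_pos.2 hpos
  have h1 : ((√(v ⬝ᵥ v))⁻¹ • v) ⬝ᵥ ((√(v ⬝ᵥ v))⁻¹ • v) = 1 := by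
    rw [smul_dotProduct, dotProduct_smul, smul_eq_mul, smul_eq_mul, ← mul_assoc, ← sq, inv_pow, hs,
      inv_mul_cancel₀ hpos.ne']
  refine ⟨_, h1.le, fun _ => h1, fun x => ?_⟩
  rw [smul_dotProduct, smul_eq_mul, mul_pow, inv_pow, hs, mul_inv_cancel_left₀ hpos.ne']

theorem exists_unit_dominating {v : Fin (d + 1) → ℝ} (hv : v ⬝ᵥ v ≤ 1) :
    ∃ w, w ⬝ᵥ w = 1 ∧ ∀ x, (v ⬝ᵥ x) ^ 2 ≤ (w ⬝ᵥ x) ^ 2 := by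
  rcases eq_or_ne v 0 with rfl | hv0
  · exact ⟨Pi.single 0 1, by simp, fun x => by simpa using sq_nonneg _⟩
  obtain ⟨w, -, hw, hvw⟩ := exists_normalization v
  refine ⟨w, hw hv0, fun x => ?_⟩
  rw [hvw]
  exact mul_le_of_le_one_left (sq_nonneg _) hv

/-- Each step loses `ε` for a short column and `ε` for a long row. The columns met have lengths `m,
m - 1, ..., m - d + 1`, all at least `k₀`. The bound `d₀` stays fixed while `d` decreases, so `hup`
survives the induction. -/
theorem measureReal_not_hasQuadLowerBound_le {α β ε : ℝ} {k₀ d₀ : ℕ} (hk₀ : 1 ≤ k₀) (hε : 0 ≤ ε)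
    (hα : 0 < α) (hβ : 0 ≤ β) (hαβ : β ≤ α)
    (hlow : ∀ k, k₀ ≤ k → (stdGaussian (EuclideanSpace ℝ (Fin k))).real {x | ‖x‖ < α} ≤ ε)
    (hup : ∀ k, k ≤ d₀ → (stdGaussian (EuclideanSpace ℝ (Fin k))).real {x | β < ‖x‖} ≤ ε)
    (d m : ℕ) (hd : d ≤ d₀) (hm : k₀ + d ≤ m + 1) (v : Fin d → ℝ) (hv : v ⬝ᵥ v ≤ 1) :
    (stdGaussian (EuclideanSpace ℝ (Fin m × Fin d))).real
      {G | ¬ HasQuadLowerBound α β v (matrixOfVec G)} ≤ 2 * d * ε := by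
  induction d generalizing m with
  | zero =>
    have : {G : EuclideanSpace ℝ (Fin m × Fin 0) | ¬ HasQuadLowerBound α β v (matrixOfVec G)} =
        ∅ := by
      ext G
      simp [HasQuadLowerBound, dotProduct]
    rw [this]
    simp
  | succ d ih =>
    obtain ⟨m, rfl⟩ : ∃ m', m = m' + 1 := ⟨m - 1, by omega⟩
    obtain ⟨w, hw, hvw⟩ := exists_unit_dominating hv
    obtain ⟨V, hV⟩ := exists_isOrthFrame w hw
    -- `R` rebuilds the matrix from its column along `w` and its columns along `V`, so that the bad
    -- event becomes a set in the product space.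
    let R : EuclideanSpace ℝ (Fin (m + 1)) → Matrix (Fin (m + 1)) (Fin d) ℝ →
        Matrix (Fin (m + 1)) (Fin (d + 1)) ℝ :=
      fun a C => vecMulVec (WithLp.ofLp a) w + C * Vᵀ
    have hRc : Continuous fun p : EuclideanSpace ℝ (Fin (m + 1)) × Matrix (Fin (m + 1)) (Fin d) ℝ =>
        R p.1 p.2 := by
      refine Continuous.add (continuous_matrix fun i j => ?_) (by fun_prop)
      simp only [vecMulVec_apply]
      fun_prop
    have hVT : Vᵀ *ᵥ w = 0 := hV.transpose_mulVec
    have hwV : w ᵥ* V = 0 := by rw [← mulVec_transpose, hVT]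
    have hRw : ∀ a C, R a C *ᵥ w = WithLp.ofLp a := fun a C => by
      simp only [R, add_mulVec, ← mulVec_mulVec, hVT, mulVec_zero, add_zero]
      rw [vecMulVec_mulVec, hw]
      simp
    have hRV : ∀ a C, R a C * V = C := fun a C => by
      simp only [R, Matrix.add_mul, Matrix.mul_assoc, hV.transpose_mul, Matrix.mul_one]
      rw [vecMulVec_mul, hwV]
      exact add_eq_right.2 (Matrix.ext fun i j => mul_zero _)
    have hRG : ∀ G : Matrix (Fin (m + 1)) (Fin (d + 1)) ℝ,
        R (WithLp.toLp 2 (G *ᵥ w)) (G * V) = G := fun G => by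
      simp only [R]
      rw [← mul_vecMulVec, Matrix.mul_assoc, ← Matrix.mul_add, hV.vecMulVec_add_mul_transpose,
        Matrix.mul_one]
    let S : Set (EuclideanSpace ℝ (Fin (m + 1)) × EuclideanSpace ℝ (Fin (m + 1) × Fin d)) :=
      {p | ¬ HasQuadLowerBound α β w (R p.1 (matrixOfVec p.2))}
    have hS : MeasurableSet S :=
      (isClosed_hasQuadLowerBound (by fun_prop) α β w).measurableSet.compl
    have hsub : {G : EuclideanSpace ℝ (Fin (m + 1) × Fin (d + 1)) |
          ¬ HasQuadLowerBound α β v (matrixOfVec G)} ⊆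
        {G | (WithLp.toLp 2 (matrixOfVec G *ᵥ w), vecOfMatrix (matrixOfVec G * V)) ∈ S} := by
      intro G hG hG'
      rw [matrixOfVec_vecOfMatrix, hRG] at hG'
      refine hG fun x => (add_le_add le_rfl ?_).trans (hG' x)
      exact mul_le_mul_of_nonneg_left (hvw x) (mul_nonneg hβ (sub_nonneg.2 hαβ))
    refine (measureReal_mono hsub).trans ?_
    have hd0 : (0 : ℝ) ≤ d := d.cast_nonneg
    refine (measureReal_le_of_map_eq_prod (Continuous.measurable (by fun_prop))
      (map_columns_stdGaussian hV) hS
      (N := {a | ‖a‖ < α}) (measurableSet_lt (by fun_prop) (by fun_prop)) (δ := ε + 2 * d * ε)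
      (by positivity) (hlow _ (by omega)) fun a ha => ?_).trans (by push_cast; linarith)
    have ha' : α ≤ ‖a‖ := not_lt.1 ha
    have ha0 : 0 < ‖a‖ := hα.trans_le ha'
    set u : Fin (m + 1) → ℝ := ‖a‖⁻¹ • WithLp.ofLp a with hu
    have hau : WithLp.ofLp a = ‖a‖ • u := by rw [hu, smul_smul, mul_inv_cancel₀ ha0.ne', one_smul]
    have huu : u ⬝ᵥ u = 1 := by
      rw [hu, smul_dotProduct, dotProduct_smul, ← norm_sq_eq_dotProduct]
      simp only [smul_eq_mul]
      field_simp
    obtain ⟨U, hU⟩ := exists_isOrthFrame u huu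
    have hUT : Uᵀ *ᵥ u = 0 := hU.transpose_mulVec
    -- The same for rows. Here `a` is frozen, so the frame `u`, `U` built from it is deterministic.
    let Q : EuclideanSpace ℝ (Fin d) → Matrix (Fin m) (Fin d) ℝ → Matrix (Fin (m + 1)) (Fin d) ℝ :=
      fun b B => vecMulVec u (WithLp.ofLp b) + U * B
    have hQc : Continuous fun p : EuclideanSpace ℝ (Fin d) × Matrix (Fin m) (Fin d) ℝ =>
        Q p.1 p.2 := by
      refine Continuous.add (continuous_matrix fun i j => ?_) (by fun_prop)
      simp only [vecMulVec_apply]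
      fun_prop
    have hQu : ∀ b B, (Q b B)ᵀ *ᵥ u = WithLp.ofLp b := fun b B => by
      simp only [Q, transpose_add, add_mulVec, transpose_mul, ← mulVec_mulVec, hUT, mulVec_zero,
        add_zero, transpose_vecMulVec]
      rw [vecMulVec_mulVec, huu]
      simp
    have hQU : ∀ b B, Uᵀ * Q b B = B := fun b B => by
      simp only [Q, Matrix.mul_add, ← Matrix.mul_assoc, hU.transpose_mul, Matrix.one_mul,
        mul_vecMulVec, hUT, zero_vecMulVec, zero_add]
    have hQC : ∀ C : Matrix (Fin (m + 1)) (Fin d) ℝ,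
        Q (WithLp.toLp 2 (Cᵀ *ᵥ u)) (Uᵀ * C) = C := fun C => by
      simp only [Q]
      rw [mulVec_transpose, ← vecMulVec_mul, ← Matrix.mul_assoc, ← Matrix.add_mul,
        hU.vecMulVec_add_mul_transpose, Matrix.one_mul]
    let T : Set (EuclideanSpace ℝ (Fin d) × EuclideanSpace ℝ (Fin m × Fin d)) :=
      {p | ¬ HasQuadLowerBound α β w (R a (Q p.1 (matrixOfVec p.2)))}
    have hT : MeasurableSet T :=
      (isClosed_hasQuadLowerBound (by fun_prop) α β w).measurableSet.compl
    have hST : Prod.mk a ⁻¹' S =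
        {C | (WithLp.toLp 2 ((matrixOfVec C)ᵀ *ᵥ u), vecOfMatrix (Uᵀ * matrixOfVec C)) ∈ T} := by
      ext C
      simp only [S, T, Set.mem_preimage, Set.mem_ofPred_eq, matrixOfVec_vecOfMatrix, hQC]
    rw [hST]
    refine measureReal_le_of_map_eq_prod (Continuous.measurable (by fun_prop))
      (map_rows_stdGaussian hU) hT
      (N := {b | β < ‖b‖}) (measurableSet_lt (by fun_prop) (by fun_prop))
      (by positivity) (hup _ (by omega)) fun b hb => ?_
    have hb' : ‖b‖ ≤ β := not_lt.1 hb
    have hbw : ∃ w' : Fin d → ℝ, w' ⬝ᵥ w' ≤ 1 ∧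
        ∀ y, (WithLp.ofLp b ⬝ᵥ y) ^ 2 ≤ β ^ 2 * (w' ⬝ᵥ y) ^ 2 := by
      obtain ⟨w', hw', -, hbw'⟩ := exists_normalization (WithLp.ofLp b)
      refine ⟨w', hw', fun y => ?_⟩
      rw [hbw', ← norm_sq_eq_dotProduct]
      gcongr
    obtain ⟨w', hw', hbw'⟩ := hbw
    refine (measureReal_mono fun B hB => ?_).trans (ih m (by omega) (by omega) w' hw')
    intro hB'
    refine hB (HasQuadLowerBound.of_frames hβ hαβ hV hU ha' ?_ (w := w') ?_ ?_)
    · rw [hRw, hau]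
    · simpa only [hRV, hQu] using hbw'
    · simpa only [hRV, hQU] using hB'

end GaussianMatrices

/-! ### From quadratic bounds to singular values, and the numerical comparison. -/

section SmallestSingularValue

open Matrix

theorem le_singularValues_of_forall_le {E F : Type*} [NormedAddCommGroup E]
    [InnerProductSpace ℝ E] [FiniteDimensional ℝ E] [NormedAddCommGroup F] [InnerProductSpace ℝ F]
    [FiniteDimensional ℝ F] {T : E →ₗ[ℝ] F} {c : ℝ} (h : ∀ x, c ^ 2 * ‖x‖ ^ 2 ≤ ‖T x‖ ^ 2) {i : ℕ}
    (hi : i < Module.finrank ℝ E) : c ≤ T.singularValues i := by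
  obtain ⟨x, hx⟩ := (T.hasEigenvalue_adjoint_comp_self_sq_singularValues hi).exists_hasEigenvector
  have hx0 : 0 < ‖x‖ ^ 2 := pow_pos (norm_pos_iff.2 hx.2) 2
  have h1 : ‖T x‖ ^ 2 = T.singularValues i ^ 2 * ‖x‖ ^ 2 := by
    rw [← real_inner_self_eq_norm_sq, ← LinearMap.adjoint_inner_right, ← LinearMap.comp_apply,
      hx.apply_eq_smul, real_inner_smul_right, real_inner_self_eq_norm_sq]
    rfl
  have h2 := h x
  rw [h1] at h2
  exact le_of_sq_le_sq (le_of_mul_le_mul_right h2 hx0) (T.singularValues_nonneg i)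

theorem le_singularValues_toEuclideanLin {n d : ℕ} (hd : 1 ≤ d) {M : Matrix (Fin n) (Fin d) ℝ}
    {c : ℝ} (h : ∀ x, c ^ 2 * (x ⬝ᵥ x) ≤ (M *ᵥ x) ⬝ᵥ (M *ᵥ x)) :
    c ≤ (Matrix.toEuclideanLin M).singularValues (d - 1) := by
  refine le_singularValues_of_forall_le (fun x => ?_) (by simp; omega)
  rw [norm_sq_eq_dotProduct, norm_sq_eq_dotProduct]
  exact h _

theorem map_vecOfMatrix_eq_stdGaussian {Ω : Type*} [MeasurableSpace Ω] {μ : Measure Ω}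
    [IsProbabilityMeasure μ] {n d : ℕ} {E : Ω → Matrix (Fin n) (Fin d) ℝ}
    (hlaw : ∀ i j, HasLaw (fun ω => E ω i j) (gaussianReal 0 1) μ)
    (hindep : iIndepFun (fun (p : Fin n × Fin d) (ω : Ω) => E ω p.1 p.2) μ) :
    AEMeasurable (fun ω => vecOfMatrix (E ω)) μ ∧
      μ.map (fun ω => vecOfMatrix (E ω)) = stdGaussian (EuclideanSpace ℝ (Fin n × Fin d)) := by
  have hm : ∀ p : Fin n × Fin d, AEMeasurable (fun ω => E ω p.1 p.2) μ :=
    fun p => (hlaw p.1 p.2).aemeasurable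
  have hm' : AEMeasurable (fun ω (p : Fin n × Fin d) => E ω p.1 p.2) μ := aemeasurable_pi_iff.2 hm
  have ht : Measurable (WithLp.toLp 2 : (Fin n × Fin d → ℝ) → EuclideanSpace ℝ (Fin n × Fin d)) :=
    by fun_prop
  refine ⟨ht.comp_aemeasurable hm', ?_⟩
  have h := hindep.map_fun_eq_pi_map hm
  simp_rw [fun p : Fin n × Fin d => (hlaw p.1 p.2).map_eq] at h
  rw [← map_pi_eq_stdGaussian, ← h, AEMeasurable.map_map_of_aemeasurable ht.aemeasurable hm']
  rfl

/-- Smallest singular value of a shifted Gaussian matrix, in terms of tail bounds for the norms of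
standard Gaussian vectors. -/
theorem le_measureReal_le_singularValues {Ω : Type*} [MeasurableSpace Ω] (μ : Measure Ω)
    [IsProbabilityMeasure μ] {m d : ℕ} (hd : 1 ≤ d) (A : Matrix (Fin (m + d)) (Fin d) ℝ)
    (E : Ω → Matrix (Fin (m + d)) (Fin d) ℝ)
    (hlaw : ∀ i j, HasLaw (fun ω => E ω i j) (gaussianReal 0 1) μ)
    (hindep : iIndepFun (fun (p : Fin (m + d) × Fin d) (ω : Ω) => E ω p.1 p.2) μ)
    {α β ε : ℝ} {k₀ : ℕ} (hk₀ : 1 ≤ k₀) (hm : k₀ + d ≤ m + 1) (hε : 0 ≤ ε)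
    (hα : 0 < α) (hβ : 0 ≤ β) (hαβ : β ≤ α)
    (hlow : ∀ k, k₀ ≤ k → (stdGaussian (EuclideanSpace ℝ (Fin k))).real {x | ‖x‖ < α} ≤ ε)
    (hup : ∀ k, k ≤ d → (stdGaussian (EuclideanSpace ℝ (Fin k))).real {x | β < ‖x‖} ≤ ε) :
    1 - 2 * d * ε ≤
      μ.real {ω | α - β ≤ (Matrix.toEuclideanLin (A + E ω)).singularValues (d - 1)} := by
  obtain ⟨U, hU, hUA⟩ := exists_orthonormal_columns_orthogonal A
  obtain ⟨hEm, hE⟩ := map_vecOfMatrix_eq_stdGaussian hlaw hindep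
  have hbad := measureReal_not_hasQuadLowerBound_le hk₀ hε hα hβ hαβ hlow hup d m le_rfl hm 0
    (by simp)
  have hclosed : MeasurableSet {G : EuclideanSpace ℝ (Fin m × Fin d) |
      HasQuadLowerBound α β 0 (matrixOfVec G)} :=
    (isClosed_hasQuadLowerBound (by fun_prop) α β 0).measurableSet
  have hP : Measurable fun G : EuclideanSpace ℝ (Fin (m + d) × Fin d) =>
      vecOfMatrix (Uᵀ * matrixOfVec G) := Continuous.measurable (by fun_prop)
  have hcompl := probReal_compl_eq_one_sub
    (μ := stdGaussian (EuclideanSpace ℝ (Fin m × Fin d))) hclosed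
  rw [Set.compl_ofPred] at hcompl
  rw [hcompl, ← map_compression_stdGaussian hU, map_measureReal_apply hP hclosed, ← hE,
    measureReal_def, Measure.map_apply_of_aemeasurable hEm (hP hclosed), ← measureReal_def] at hbad
  refine le_trans (by linarith) (measureReal_mono (fun ω hω => ?_))
  have hω' : HasQuadLowerBound α β 0 (Uᵀ * E ω) := hω
  refine le_singularValues_toEuclideanLin hd fun x => ?_
  calc (α - β) ^ 2 * (x ⬝ᵥ x) ≤ ((Uᵀ * E ω) *ᵥ x) ⬝ᵥ ((Uᵀ * E ω) *ᵥ x) := by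
        simpa using hω' x
    _ = (Uᵀ *ᵥ ((A + E ω) *ᵥ x)) ⬝ᵥ (Uᵀ *ᵥ ((A + E ω) *ᵥ x)) := by
        rw [mulVec_mulVec, Matrix.mul_add, hUA, zero_add]
    _ ≤ _ := dot_transpose_mulVec_le hU _

/-- With `N = √n`, `D = √d` and `K = √(n - 2d + 1)`, the claim is `N - K ≤ t * (D - 1 / √2)`. The
left side is `(2 * D ^ 2 - 1) / (N + K)`, and `hN` makes `N + K` large. -/
theorem threshold_comparison {N K D t : ℝ} (hD : 1 ≤ D) (ht : 1.45 ≤ t) (hK : 0 ≤ K)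
    (hNK : K ^ 2 = N ^ 2 - 2 * D ^ 2 + 1) (hN : (1 + t) * D + t ≤ N) :
    N - (1 + t) * D - t ≤ (K - t / √2) - (D + t) := by
  have hN' : 2.45 * D + 1.45 ≤ N := by nlinarith
  have hK' : 2 * D + 1.45 ≤ K := by
    refine le_of_sq_le_sq ?_ hK
    nlinarith
  have h2 : 1 / √2 ≤ 0.7072 := by
    rw [div_le_iff₀ (by positivity)]
    have : 1.4141 ≤ √2 := Real.le_sqrt_of_sq_le (by norm_num)
    linarith
  have h3 : (N - K) * (4.45 * D + 2.9) ≤ 2 * D ^ 2 := by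
    by_cases h : N ≤ K
    · nlinarith
    · have : (N - K) * (4.45 * D + 2.9) ≤ (N - K) * (N + K) :=
        mul_le_mul_of_nonneg_left (by linarith) (by linarith)
      nlinarith
  have h4 : N - K ≤ 1.45 * (D - 0.7072) := by
    refine le_of_mul_le_mul_right (h3.trans ?_) (show 0 < 4.45 * D + 2.9 by linarith)
    nlinarith
  have h5 : t / √2 ≤ t * 0.7072 := by
    rw [div_eq_mul_one_div]
    gcongr
  nlinarith

/-- The hypothesis means `t > √(2 log 3) ≈ 1.48`. The proof uses `1.45 ^ 2 / 2 = 1.05125` and `exp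
1.05125 ≤ 2.9 < 3`. -/
theorem lt_of_three_mul_exp_lt_one {t : ℝ} (ht : 0 < t) (h : 3 * Real.exp (-t ^ 2 / 2) < 1) :
    1.45 ≤ t := by
  by_contra! hlt
  have h1 : Real.exp (-1.05125) ≤ Real.exp (-t ^ 2 / 2) := Real.exp_le_exp.2 (by nlinarith)
  have h2 : Real.exp (-1.05125) * (Real.exp 1 * Real.exp 0.05125) = 1 := by
    rw [← Real.exp_add, ← Real.exp_add]
    norm_num
  have h3 : Real.exp 0.05125 * (1 - 0.05125) ≤ 1 := by
    have := Real.one_sub_le_exp_neg 0.05125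
    calc _ ≤ Real.exp 0.05125 * Real.exp (-0.05125) := by gcongr
      _ = 1 := by rw [← Real.exp_add]; norm_num
  have h4 := Real.exp_one_lt_d9
  have h5 : Real.exp 1 * Real.exp 0.05125 ≤ 2.9 := by
    have : Real.exp 0.05125 ≤ 1.0541 := by linarith
    calc _ ≤ 2.7182818286 * 1.0541 := by gcongr
      _ ≤ (2.9 : ℝ) := by norm_num
  have h6 : Real.exp (-1.05125) * (Real.exp 1 * Real.exp 0.05125) ≤ Real.exp (-1.05125) * 2.9 := by
    gcongr
  linarith [Real.exp_pos (-1.05125)]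

end SmallestSingularValue

/-- Singular values are Mathlib's: listed in nonincreasing order with multiplicity and indexed
from `0`, so that the entry with index `d - 1` is `σ_d`, the square root of the smallest
eigenvalue of `MᵀM`. -/
theorem mainTheorem4 {Ω : Type*} [MeasurableSpace Ω] (μ : Measure Ω) [IsProbabilityMeasure μ]
    (n d : ℕ) (hd : 1 ≤ d)
    (A : Matrix (Fin n) (Fin d) ℝ)
    (E : Ω → Matrix (Fin n) (Fin d) ℝ)
    (hlaw : ∀ i j, HasLaw (fun ω => E ω i j) (gaussianReal 0 1) μ)
    (hindep : iIndepFun (fun (p : Fin n × Fin d) (ω : Ω) => E ω p.1 p.2) μ)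
    (t : ℝ) (ht : 0 < t) :
    1 - (2 * (d : ℝ) + 1) * Real.exp (-t ^ 2 / 2) ≤
      μ.real {ω | Real.sqrt n - (1 + t) * Real.sqrt d - t ≤
        (Matrix.toEuclideanLin (A + E ω)).singularValues (d - 1)} := by
  have hε := Real.exp_pos (-t ^ 2 / 2)
  have hd' : (1 : ℝ) ≤ d := by exact_mod_cast hd
  rcases le_or_gt (1 - (2 * (d : ℝ) + 1) * Real.exp (-t ^ 2 / 2)) 0 with hε1 | hε1
  · exact hε1.trans measureReal_nonneg
  rcases le_or_gt (√(n : ℝ) - (1 + t) * √(d : ℝ) - t) 0 with h0 | h0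
  · have : {ω | √(n : ℝ) - (1 + t) * √(d : ℝ) - t ≤
        (Matrix.toEuclideanLin (A + E ω)).singularValues (d - 1)} = Set.univ :=
      Set.eq_univ_of_forall fun ω => h0.trans (LinearMap.singularValues_nonneg _ _)
    rw [this, probReal_univ]
    nlinarith
  -- The bound is nontrivial and `d ≥ 1`, so `3 * exp (-t ^ 2 / 2) < 1`. This is where the `+ 1` in
  -- `2 * d + 1` serves; the union bound alone needs `2 * d`.
  have ht' : 1.45 ≤ t := lt_of_three_mul_exp_lt_one ht (by nlinarith)
  have hD : 1 ≤ √(d : ℝ) := Real.one_le_sqrt.2 hd'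
  have hDD : √(d : ℝ) ^ 2 = d := Real.sq_sqrt (by positivity)
  have hNN : √(n : ℝ) ^ 2 = n := Real.sq_sqrt (by positivity)
  have hnd : 2 * d ≤ n := by
    have h1 : 2 * √(d : ℝ) ≤ √(n : ℝ) := by nlinarith
    have h2 : (2 * √(d : ℝ)) ^ 2 ≤ √(n : ℝ) ^ 2 := pow_le_pow_left₀ (by positivity) h1 2
    have h3 : (2 * d : ℝ) ≤ n := by nlinarith
    exact_mod_cast h3
  obtain ⟨m, rfl⟩ : ∃ m, n = m + d := ⟨n - d, by omega⟩
  -- Now `n = k + 2d`: `d` rows go to removing `A`, and the shortest column met later has length `k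
  -- + 1`.
  obtain ⟨k, rfl⟩ : ∃ k, m = k + d := ⟨m - d, by omega⟩
  have hcmp := threshold_comparison (N := √((k + d + d : ℕ) : ℝ)) (K := √((k + 1 : ℕ) : ℝ))
    hD ht' (Real.sqrt_nonneg _)
    (by rw [Real.sq_sqrt (by positivity), hNN, hDD]; push_cast; ring) (by linarith)
  have hβ : 0 ≤ √(d : ℝ) + t := by positivity
  have hmain := le_measureReal_le_singularValues μ hd A E hlaw hindep
    (α := √((k + 1 : ℕ) : ℝ) - t / √2) (β := √(d : ℝ) + t) (k₀ := k + 1) (by omega) (by omega)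
    hε.le (by linarith) hβ (by linarith)
    (fun j hj => ?_) (fun j hj => ?_)
  · refine le_trans (by linarith) (hmain.trans (measureReal_mono fun ω hω => ?_))
    exact hcmp.trans hω
  · refine (measureReal_mono fun x hx => ?_).trans ((stdGaussian_norm_lt_le j
      (s := t / √2) (by positivity)).trans_eq ?_)
    · refine lt_of_lt_of_le (show ‖x‖ < _ from hx) ?_
      gcongr
    · rw [div_pow, Real.sq_sqrt zero_le_two, neg_div]
  · refine (measureReal_mono fun x hx => ?_).trans (stdGaussian_norm_ge_le j ht)
    refine le_trans ?_ (le_of_lt (show _ < ‖x‖ from hx))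
    gcongr
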